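/- Let $X$ be a real or complex Banach space. A function $f:\mathbb{R}\to X$ is called recurrent if it is continuous and if, for every compact $K\subset\mathbb{R}$ and every $\varepsilon>0$, the set $E(f,\varepsilon,K)=\{\tau\in\mathbb{R} : \|f(t+\tau)-f(t)\|\le\varepsilon \text{ for all } t\in K\}$ is relatively dense, i.e. there is a compact $L\subset\mathbb{R}$ with $E(f,\varepsilon,K)+L=\mathbb{R}$. Let $REC(\mathbb{R},X)$ be the set of recurrent functions and $C_b(\mathbb{R},X)$ the set of bounded continuous functions from $\mathbb{R}$ to $X$. A set $M\subset X$ is called relatively weakly sequentially complete if for every weakly Cauchy sequence $(x_n)$ with all $x_n\in M$ there is $a\in X$ with $x_n\to a$ weakly. Let $C_{b,wscp}(\mathbb{R},X)$ be the set of all $f\in C_b(\mathbb{R},X)$ whose range $f(\mathbb{R})$ is relatively weakly sequentially complete. Write $c_0\not\subset X$ if no linear subspace of $X$ is linearly homeomorphic to the Banach space $c_0$ of null sequences of scalars. Put $\Delta_hF(t)=F(t+h)-F(t)$ and, for locally integrable $f$, $Pf(t)=\int_0^t f(s)\,ds$. **Theorem 4.5.** Assume that either (i) $U=C_b(\mathbb{R},X)$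 and $c_0\not\subset X$, or (ii) $U=C_{b,wscp}(\mathbb{R},X)$ (with $X$ arbitrary). Then $REC(\mathbb{R},X)$ satisfies both of the following conditions: $(L_U)$ if $F\in U$ and $\Delta_hF\in REC(\mathbb{R},X)$ for all $h>0$, then $F\in REC(\mathbb{R},X)$; $(P_U)$ if $f\in REC(\mathbb{R},X)$ and $Pf\in U$, then $Pf\in REC(\mathbb{R},X)$. -/

import Mathlib

open scoped Pointwise ZeroAtInfty

namespace RecurrentFunctions

section Recurrence

variable {G X : Type*} [AddCommGroup G] [TopologicalSpace G] [NormedAddCommGroup X]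

/-- The set `E(f, ε, K)` of `ε`-`K`-periods of `f`. -/
def periods (f : G → X) (ε : ℝ) (K : Set G) : Set G :=
  {τ | ∀ t ∈ K, ‖f (t + τ) - f t‖ ≤ ε}

/-- `E` is relatively dense if `E + L = G` for some compact `L`. -/
def IsRelativelyDense (E : Set G) : Prop :=
  ∃ L : Set G, IsCompact L ∧ E + L = Set.univ

/-- Recurrent functions: continuous, and all sets of `ε`-`K`-periods, for `K` compact and
`ε > 0`, are relatively dense. -/
def IsRecurrent (f : G → X) : Prop :=
  Continuous f ∧
    ∀ K : Set G, IsCompact K → ∀ ε : ℝ, 0 < ε → IsRelativelyDense (periods f ε K)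

end Recurrence

/-- The set `REC(G, X)` of recurrent functions. -/
def REC (G X : Type*) [AddCommGroup G] [TopologicalSpace G] [NormedAddCommGroup X] :
    Set (G → X) :=
  {f | IsRecurrent f}

/-- The set `C_b(T, X)` of bounded continuous functions. -/
def Cb (T X : Type*) [TopologicalSpace T] [NormedAddCommGroup X] : Set (T → X) :=
  {f | Continuous f ∧ Bornology.IsBounded (Set.range f)}

/-- `M` is relatively weakly sequentially complete: every weakly Cauchy sequence with terms in `M`
converges weakly to some point of the whole space `X`. -/
def IsRelWeaklySeqComplete (𝕜 : Type*) {X : Type*} [RCLike 𝕜] [NormedAddCommGroup X]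
    [NormedSpace 𝕜 X] (M : Set X) : Prop :=
  ∀ x : ℕ → X, (∀ n, x n ∈ M) →
    (∀ φ : StrongDual 𝕜 X, CauchySeq fun n => φ (x n)) →
    ∃ a : X, ∀ φ : StrongDual 𝕜 X, Filter.Tendsto (fun n => φ (x n)) Filter.atTop (nhds (φ a))

/-- The set `C_{b,wscp}(T, X)` of bounded continuous functions with relatively weakly sequentially
complete range. -/
def CbWscp (𝕜 T X : Type*) [RCLike 𝕜] [TopologicalSpace T] [NormedAddCommGroup X]
    [NormedSpace 𝕜 X] : Set (T → X) :=
  {f | f ∈ Cb T X ∧ IsRelWeaklySeqComplete 𝕜 (Set.range f)}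

/-- `c₀ ⊂ X`: some linear subspace of `X` is isomorphic, as a topological vector space, to the
Banach space `c₀` of scalar null sequences with the supremum norm. -/
def ContainsC0 (𝕜 X : Type*) [RCLike 𝕜] [NormedAddCommGroup X] [NormedSpace 𝕜 X] : Prop :=
  ∃ Y : Submodule 𝕜 X, Nonempty (C₀(ℕ, 𝕜) ≃L[𝕜] Y)

/-- The Loomis condition `(L_U)` for `A`: if `F ∈ U` and all differences
`Δ_h F = F(· + h) - F`, `h > 0`, are in `A`, then `F ∈ A`. -/
def LoomisCondition {X : Type*} [NormedAddCommGroup X] (A U : Set (ℝ → X)) : Prop :=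
  ∀ F ∈ U, (∀ h : ℝ, 0 < h → (fun t => F (t + h) - F t) ∈ A) → F ∈ A

/-- The indefinite integral `Pf(t) = ∫₀ᵗ f(s) ds`. -/
noncomputable def indefIntegral {X : Type*} [NormedAddCommGroup X] [NormedSpace ℝ X]
    (f : ℝ → X) : ℝ → X :=
  fun t => ∫ s in (0 : ℝ)..t, f s

/-- The condition `(P_U)` for `A`: if `f ∈ A` has an indefinite integral `Pf` and `Pf ∈ U`, then
`Pf ∈ A`. The integral is meant for locally integrable `f`; all continuous `f` are. -/
def IntegralCondition {X : Type*} [NormedAddCommGroup X] [NormedSpace ℝ X]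
    (A U : Set (ℝ → X)) : Prop :=
  ∀ f ∈ A, MeasureTheory.LocallyIntegrable f → indefIntegral f ∈ U → indefIntegral f ∈ A

end RecurrentFunctions

/-! Suppose `F` is bounded, its differences are recurrent, and `F` is not. Since `Δ_h Δ_τ F = Δ_τ
Δ_h F`, an almost period `τ` of `Δ_h F` makes `Δ_τ F` almost `h`-periodic on a large ball. Such `τ`
are relatively dense, so some of them are not almost periods of `F`, and then `Δ_τ F` is large
somewhere (`exists_large_shiftDiff`). Iterating with finer `h` and nested intervals gives a point
`t` and shifts `τₙ` such that `xₙ = Δ_{τₙ} F(t)` stays away from zero while `∑_{i ∈ A} xᵢ` is within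
2 of `F(t + ∑_{i ∈ A} τᵢ) - F(t)`. Boundedness of `F` bounds all subset sums, and Bessaga–Pełczyński
(via Rosenthal's lemma) yields a copy of `c₀`, which settles (i).

For (ii), the partial sums of the `c₀` basis differ from a sequence in the range of `F` by a norm
convergent one. Both are weakly Cauchy, but the former has no weak limit. Finally `(P_U)` follows
from `(L_U)`, because `Δ_h Pf` is an average of translates of `f` up to the factor `h`. -/

namespace RecurrentFunctions

open Filter Topology

/-! ### Rosenthal's disjointification lemma -/

section Rosenthal

open scoped ENNReal

/-- **Rosenthal's lemma**: a nonnegative matrix whose off-diagonal row sums are uniformly bounded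
has an infinite principal submatrix with small off-diagonal row sums. -/
theorem exists_injective_offDiag_tsum_le {δ : ℝ≥0∞} (hδ : δ ≠ ∞) (p : ℕ) :
    ∀ r : ℕ → ℕ → ℝ≥0∞, (∀ n, ∑' m, (if m = n then 0 else r n m) ≤ p * δ) →
      ∃ g : ℕ → ℕ, Function.Injective g ∧
        ∀ n, ∑' m, (if m = n then 0 else r (g n) (g m)) ≤ δ := by
  induction p with
  | zero =>
    intro r hr
    exact ⟨id, Function.injective_id, fun n => (hr n).trans (by simp)⟩
  | succ p ih =>
    intro r hr
    -- Pairing splits `ℕ` into infinitely many infinite blocks. Either one block already works, or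
    -- each block `k` has a row `j k` with mass above `δ` inside its own block. One such row per
    -- block leaves at most `p * δ` for the columns in other blocks.
    by_cases hk : ∃ k, ∀ j,
        ∑' i, (if i = j then 0 else r (Nat.pair k j) (Nat.pair k i)) ≤ δ
    · obtain ⟨k, hk⟩ := hk
      exact ⟨Nat.pair k, fun a b h => (Nat.pair_eq_pair.1 h).2, hk⟩
    · push Not at hk
      choose j hj using hk
      have hg : Function.Injective fun k => Nat.pair k (j k) :=
        fun a b h => (Nat.pair_eq_pair.1 h).1
      obtain ⟨g, hgi, hgs⟩ := ih (fun n m => r (Nat.pair n (j n)) (Nat.pair m (j m))) (by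
        intro n
        set f : ℕ → ℝ≥0∞ := fun m =>
          if m = Nat.pair n (j n) then 0 else r (Nat.pair n (j n)) m with hf
        have hle : δ + ∑' k, (if k = n then 0 else f (Nat.pair k (j k))) ≤ δ + p * δ := by
          calc δ + ∑' k, (if k = n then 0 else f (Nat.pair k (j k)))
              ≤ (∑' i, f (Nat.pair n i)) +
                ∑' k, (if k = n then 0 else ∑' i, f (Nat.pair k i)) := by
                refine add_le_add ((hj n).le.trans (le_of_eq ?_)) (ENNReal.tsum_le_tsum fun k => ?_)
                · refine tsum_congr fun i => ?_
                  simp [hf]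
                · split_ifs
                  · exact le_rfl
                  · exact ENNReal.le_tsum (j k)
            _ = ∑' k, ∑' i, f (Nat.pair k i) := by
                rw [ENNReal.tsum_eq_add_tsum_ite (f := fun k => ∑' i, f (Nat.pair k i)) n]
                refine congrArg _ (tsum_congr fun k => ?_)
                split_ifs <;> rfl
            _ = ∑' q : ℕ × ℕ, f (Nat.pair q.1 q.2) :=
                (ENNReal.tsum_prod (f := fun a b => f (Nat.pair a b))).symm
            _ = ∑' m, f m := Nat.pairEquiv.tsum_eq f
            _ ≤ (p + 1 : ℕ) * δ := hr _
            _ = δ + p * δ := by push_cast; ring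
        refine le_trans (le_of_eq (tsum_congr fun k => ?_)) ((ENNReal.add_le_add_iff_left hδ).1 hle)
        by_cases h : k = n <;> simp [hf, h])
      exact ⟨_, hg.comp hgi, hgs⟩

/-- Off-diagonal sums ignore the order of the selected indices, so the range of the injective
selection can be listed increasingly. -/
theorem exists_strictMono_offDiag_tsum_le {r : ℕ → ℕ → ℝ≥0∞} {C δ : ℝ≥0∞} (hC : C ≠ ∞)
    (hδ : δ ≠ ∞) (hδ0 : δ ≠ 0) (hr : ∀ n, ∑' m, r n m ≤ C) :
    ∃ g : ℕ → ℕ, StrictMono g ∧ ∀ n, ∑' m, (if m = n then 0 else r (g n) (g m)) ≤ δ := by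
  obtain ⟨p, hp⟩ := ENNReal.exists_nat_mul_gt hδ0 hC
  obtain ⟨g, hg, hgs⟩ := exists_injective_offDiag_tsum_le hδ p r fun n =>
    (ENNReal.tsum_le_tsum fun m => by split_ifs <;> simp).trans ((hr n).trans hp.le)
  have hinf : (Set.range g).Infinite := Set.infinite_range_of_injective hg
  have hmem : ∀ n, ∃ k, g k = Nat.nth (· ∈ Set.range g) n := fun n =>
    Nat.nth_mem_of_infinite hinf n
  have hmono : StrictMono (Nat.nth (· ∈ Set.range g)) := Nat.nth_strictMono hinf
  choose k hk using hmem
  have hkinj : Function.Injective k := fun a b h => hmono.injective (by rw [← hk, ← hk, h])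
  refine ⟨_, hmono, fun n => le_trans ?_ (hgs (k n))⟩
  refine le_trans (le_of_eq (tsum_congr fun m => ?_))
    (ENNReal.tsum_comp_le_tsum_of_injective hkinj
      fun m => if m = k n then 0 else r (g (k n)) (g m))
  simp [hkinj.eq_iff, hk]

end Rosenthal

/-! ### Bounded subset sums and weak absolute summability -/

section SubsetSums

variable {ι 𝕜 X : Type*} [RCLike 𝕜] [NormedAddCommGroup X] [NormedSpace 𝕜 X]

theorem sum_abs_le_of_subset_sums {s : Finset ι} {a : ι → ℝ} {C : ℝ}
    (h : ∀ t ⊆ s, |∑ i ∈ t, a i| ≤ C) : ∑ i ∈ s, |a i| ≤ 2 * C := by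
  classical
  rw [← Finset.sum_filter_add_sum_filter_not s (fun i => 0 ≤ a i)]
  have h1 : ∑ i ∈ s with 0 ≤ a i, |a i| ≤ C := by
    rw [Finset.sum_congr rfl fun i hi => abs_of_nonneg (Finset.mem_filter.1 hi).2]
    exact (le_abs_self _).trans (h _ (Finset.filter_subset _ _))
  have h2 : ∑ i ∈ s with ¬ 0 ≤ a i, |a i| ≤ C := by
    rw [Finset.sum_congr rfl fun i hi => abs_of_neg (not_le.1 (Finset.mem_filter.1 hi).2),
      Finset.sum_neg_distrib]
    exact (neg_le_abs _).trans (h _ (Finset.filter_subset _ _))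
  linarith

/-- The real and imaginary parts each cost `2 * C`: one `C` for the positive terms, one for the
negative. -/
theorem sum_norm_le_of_subset_sums {s : Finset ι} {a : ι → 𝕜} {C : ℝ}
    (h : ∀ t ⊆ s, ‖∑ i ∈ t, a i‖ ≤ C) : ∑ i ∈ s, ‖a i‖ ≤ 4 * C := by
  have h1 : ∑ i ∈ s, |RCLike.re (a i)| ≤ 2 * C := sum_abs_le_of_subset_sums fun t ht => by
    rw [← map_sum]
    exact (RCLike.abs_re_le_norm _).trans (h t ht)
  have h2 : ∑ i ∈ s, |RCLike.im (a i)| ≤ 2 * C := sum_abs_le_of_subset_sums fun t ht => by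
    rw [← map_sum]
    exact (RCLike.abs_im_le_norm _).trans (h t ht)
  calc ∑ i ∈ s, ‖a i‖ ≤ ∑ i ∈ s, (|RCLike.re (a i)| + |RCLike.im (a i)|) := by
        refine Finset.sum_le_sum fun i _ => ?_
        calc ‖a i‖ = ‖(RCLike.re (a i) + RCLike.im (a i) * RCLike.I : 𝕜)‖ := by
              rw [RCLike.re_add_im]
          _ ≤ _ := (norm_add_le _ _).trans <| by
              have hI : ‖(RCLike.I : 𝕜)‖ ≤ 1 := by
                by_cases h : (RCLike.I : 𝕜) = 0
                · simp [h]
                · exact (RCLike.norm_I_of_ne_zero h).le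
              rw [norm_mul, RCLike.norm_ofReal, RCLike.norm_ofReal]
              gcongr
              exact mul_le_of_le_one_right (abs_nonneg _) hI
    _ ≤ 4 * C := by rw [Finset.sum_add_distrib]; linarith

variable {x : ι → X} {C : ℝ}

theorem sum_norm_dual_le (hx : ∀ s : Finset ι, ‖∑ i ∈ s, x i‖ ≤ C) (φ : StrongDual 𝕜 X)
    (s : Finset ι) : ∑ i ∈ s, ‖φ (x i)‖ ≤ 4 * C * ‖φ‖ := by
  have := sum_norm_le_of_subset_sums (s := s) (a := fun i => φ (x i)) (C := ‖φ‖ * C)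
    fun t _ => by
      rw [← map_sum]
      exact (φ.le_opNorm _).trans (by gcongr; exact hx t)
  linarith

theorem norm_sum_smul_le (hx : ∀ s : Finset ι, ‖∑ i ∈ s, x i‖ ≤ C) {a : ι → 𝕜} {B : ℝ}
    {s : Finset ι} (hB : 0 ≤ B) (ha : ∀ i ∈ s, ‖a i‖ ≤ B) :
    ‖∑ i ∈ s, a i • x i‖ ≤ 4 * C * B := by
  have hC : 0 ≤ C := (norm_nonneg _).trans (hx ∅)
  refine NormedSpace.norm_le_dual_bound 𝕜 _ (by positivity) fun φ => ?_
  calc ‖φ (∑ i ∈ s, a i • x i)‖ = ‖∑ i ∈ s, a i * φ (x i)‖ := by simp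
    _ ≤ ∑ i ∈ s, ‖a i * φ (x i)‖ := norm_sum_le _ _
    _ ≤ ∑ i ∈ s, B * ‖φ (x i)‖ := Finset.sum_le_sum fun i hi => by
        rw [norm_mul]; gcongr; exact ha i hi
    _ ≤ B * (4 * C * ‖φ‖) := by
        rw [← Finset.mul_sum]; gcongr; exact sum_norm_dual_le hx φ s
    _ = 4 * C * B * ‖φ‖ := by ring

end SubsetSums

/-! ### Copies of `c₀` and the Bessaga–Pełczyński theorem -/

section NullSequences

variable {𝕜 X : Type*} [RCLike 𝕜] [NormedAddCommGroup X] [NormedSpace 𝕜 X]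

theorem tendsto_atTop_of_zeroAtInfty (a : C₀(ℕ, 𝕜)) : Tendsto a atTop (𝓝 0) := by
  simpa [cocompact_eq_cofinite, Nat.cofinite_eq_atTop] using zero_at_infty a

theorem norm_apply_le_of_zeroAtInfty (a : C₀(ℕ, 𝕜)) (n : ℕ) : ‖a n‖ ≤ ‖a‖ := by
  rw [← ZeroAtInftyContinuousMap.norm_toBCF_eq_norm]
  exact a.toBCF.norm_coe_le_norm n

theorem norm_le_of_zeroAtInfty {a : C₀(ℕ, 𝕜)} {M : ℝ} (h : ∀ n, ‖a n‖ ≤ M) : ‖a‖ ≤ M := by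
  rw [← ZeroAtInftyContinuousMap.norm_toBCF_eq_norm]
  exact (BoundedContinuousFunction.norm_le ((norm_nonneg _).trans (h 0))).2 h

/-- Evaluation at `n` as a functional on `c₀`. -/
noncomputable def evalZeroAtInfty (n : ℕ) : StrongDual 𝕜 C₀(ℕ, 𝕜) :=
  LinearMap.mkContinuous
    { toFun := fun a => a n
      map_add' := fun _ _ => rfl
      map_smul' := fun _ _ => rfl } 1 fun a => by
    simpa using norm_apply_le_of_zeroAtInfty a n

variable (𝕜) in
/-- The unit vectors of `c₀`. -/
def unitVector (n : ℕ) : C₀(ℕ, 𝕜) where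
  toFun := Pi.single n 1
  continuous_toFun := continuous_of_discreteTopology
  zero_at_infty' := by
    rw [cocompact_eq_cofinite, Nat.cofinite_eq_atTop]
    refine tendsto_const_nhds.congr' ?_
    filter_upwards [eventually_gt_atTop n] with m hm
    simp [hm.ne']

theorem unitVector_apply (n m : ℕ) : unitVector 𝕜 n m = if m = n then 1 else 0 :=
  Pi.single_apply n 1 m

/-- The partial sums of a copy of the unit vector basis of `c₀` have no weak limit. -/
theorem not_tendsto_weakly_sum_unitVector {Y : Submodule 𝕜 X} (e : C₀(ℕ, 𝕜) ≃L[𝕜] Y) (y : X)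
    (hy : ∀ φ : StrongDual 𝕜 X, Tendsto
      (fun n => φ (∑ i ∈ Finset.range n, (e (unitVector 𝕜 i) : X))) atTop (𝓝 (φ y))) : False := by
  have : CompleteSpace Y :=
    (completeSpace_congr (e := e.toEquiv) e.isUniformEmbedding).1 inferInstance
  have hclosed : IsClosed (Y : Set X) := (completeSpace_coe_iff_isComplete.1 this).isClosed
  -- Closed subspaces are weakly closed: otherwise a functional vanishing on `Y` separates `y`.
  have hyY : y ∈ Y := by
    by_contra hyY
    have hne : ‖Y.mkQL y‖ ≠ 0 := by
      rw [norm_ne_zero_iff]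
      exact fun h => hyY ((Submodule.Quotient.mk_eq_zero Y).1 h)
    obtain ⟨φ, -, hφ⟩ := exists_dual_vector 𝕜 (Y.mkQL y) hne
    have h0 : ∀ n, (φ.comp Y.mkQL) (∑ i ∈ Finset.range n, (e (unitVector 𝕜 i) : X)) = 0 := by
      intro n
      have : Y.mkQL (∑ i ∈ Finset.range n, (e (unitVector 𝕜 i) : X)) = 0 :=
        (Submodule.Quotient.mk_eq_zero Y).2 (Submodule.sum_mem _ fun i _ => Submodule.coe_mem _)
      rw [ContinuousLinearMap.comp_apply, this, map_zero]
    have hlim := hy (φ.comp Y.mkQL)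
    simp only [h0] at hlim
    have := tendsto_nhds_unique hlim tendsto_const_nhds
    rw [ContinuousLinearMap.comp_apply, hφ] at this
    exact hne (by exact_mod_cast this)
  obtain ⟨a, ha⟩ := e.surjective ⟨y, hyY⟩
  -- Hahn–Banach extensions of the coordinate functionals force the limit to be the constant
  -- sequence 1, which is not null.
  have hcoord : ∀ n, a n = 1 := by
    intro n
    obtain ⟨ψ, hψ, -⟩ := exists_extension_norm_eq Y
      ((evalZeroAtInfty n).comp (e.symm : Y →L[𝕜] C₀(ℕ, 𝕜)))
    have hψe : ∀ b, ψ (e b) = b n := fun b => by rw [hψ]; simp [evalZeroAtInfty]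
    have hlim := hy ψ
    rw [show y = e a by rw [ha], hψe] at hlim
    refine tendsto_nhds_unique hlim (tendsto_const_nhds.congr' ?_)
    filter_upwards [eventually_gt_atTop n] with k hk
    simp [hψe, unitVector_apply, hk]
  have := tendsto_atTop_of_zeroAtInfty a
  rw [funext hcoord] at this
  exact one_ne_zero (tendsto_nhds_unique tendsto_const_nhds this)

variable [CompleteSpace X] {x : ℕ → X} {C : ℝ}

theorem summable_smul_zeroAtInfty (hx : ∀ s : Finset ℕ, ‖∑ i ∈ s, x i‖ ≤ C) (a : C₀(ℕ, 𝕜)) :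
    Summable fun i => a i • x i := by
  have hC : 0 ≤ C := (norm_nonneg _).trans (hx ∅)
  rw [summable_iff_vanishing_norm]
  intro ε hε
  have hB : 0 < ε / (4 * C + 1) := by positivity
  obtain ⟨N, hN⟩ := Metric.tendsto_atTop.1 (tendsto_atTop_of_zeroAtInfty a) _ hB
  refine ⟨Finset.range N, fun t ht => ?_⟩
  refine (norm_sum_smul_le hx hB.le fun i hi => ?_).trans_lt ?_
  · have : N ≤ i := by
      by_contra! h
      exact Finset.disjoint_left.1 ht hi (Finset.mem_range.2 h)
    simpa using (hN i this).le
  · rw [mul_div_assoc', div_lt_iff₀ (by positivity)]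
    nlinarith

/-- The operator `a ↦ ∑ aᵢ xᵢ` on `c₀` given by a sequence with bounded subset sums. -/
noncomputable def sumOperator (hx : ∀ s : Finset ℕ, ‖∑ i ∈ s, x i‖ ≤ C) : C₀(ℕ, 𝕜) →L[𝕜] X :=
  LinearMap.mkContinuous
    { toFun := fun a => ∑' i, a i • x i
      map_add' := fun a b => by
        rw [← (summable_smul_zeroAtInfty hx a).tsum_add (summable_smul_zeroAtInfty hx b)]
        simp [add_smul]
      map_smul' := fun c a => by
        rw [RingHom.id_apply, ← (summable_smul_zeroAtInfty hx a).tsum_const_smul c]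
        simp [mul_smul] } (4 * C) fun a =>
    le_of_tendsto (summable_smul_zeroAtInfty hx a).hasSum.norm <| Eventually.of_forall fun _ =>
      norm_sum_smul_le hx (norm_nonneg a) fun i _ => norm_apply_le_of_zeroAtInfty a i

theorem hasSum_sumOperator (hx : ∀ s : Finset ℕ, ‖∑ i ∈ s, x i‖ ≤ C) (a : C₀(ℕ, 𝕜)) :
    HasSum (fun i => a i • x i) (sumOperator hx a) :=
  (summable_smul_zeroAtInfty hx a).hasSum

theorem sumOperator_unitVector (hx : ∀ s : Finset ℕ, ‖∑ i ∈ s, x i‖ ≤ C) (n : ℕ) :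
    sumOperator hx (unitVector 𝕜 n) = x n := by
  refine (hasSum_sumOperator hx _).unique ?_
  convert hasSum_ite_eq n (x n) using 2 with m
  rw [unitVector_apply]
  split_ifs with h <;> simp [h]

/-- Testing against `φ n`, the diagonal contributes at least `ε * ‖a n‖` and the rest at most `ε / 2
* ‖a‖`. After a supremum over `n` the error is absorbed. -/
theorem norm_le_norm_sumOperator (hx : ∀ s : Finset ℕ, ‖∑ i ∈ s, x i‖ ≤ C) {ε : ℝ} (hε : 0 < ε)
    {φ : ℕ → StrongDual 𝕜 X} (hφ : ∀ n, ‖φ n‖ ≤ 1) (hdiag : ∀ n, ε ≤ ‖φ n (x n)‖)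
    (hoff : ∀ n, ∀ s : Finset ℕ, n ∉ s → ∑ m ∈ s, ‖φ n (x m)‖ ≤ ε / 2) (a : C₀(ℕ, 𝕜)) :
    ‖a‖ ≤ 2 / ε * ‖sumOperator hx a‖ := by
  have key : ∀ n, ε * ‖a n‖ ≤ ‖sumOperator hx a‖ + ε / 2 * ‖a‖ := by
    intro n
    have h1 : ‖φ n (sumOperator hx a) - a n * φ n (x n)‖ ≤ ε / 2 * ‖a‖ := by
      have hs : HasSum (fun m => a m * φ n (x m)) (φ n (sumOperator hx a)) := by
        simpa using (hasSum_sumOperator hx a).mapL (φ n)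
      refine le_of_tendsto (hs.sub_const _).norm ?_
      filter_upwards [eventually_ge_atTop {n}] with s hns
      rw [← Finset.add_sum_erase s _ (hns (Finset.mem_singleton_self n)), add_sub_cancel_left]
      calc ‖∑ m ∈ s.erase n, a m * φ n (x m)‖ ≤ ∑ m ∈ s.erase n, ‖a‖ * ‖φ n (x m)‖ := by
            refine norm_sum_le_of_le _ fun m _ => ?_
            rw [norm_mul]
            gcongr
            exact norm_apply_le_of_zeroAtInfty a m
        _ ≤ ε / 2 * ‖a‖ := by
            rw [← Finset.mul_sum, mul_comm]
            gcongr
            exact hoff n _ (Finset.notMem_erase n s)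
    have h2 : ‖φ n (sumOperator hx a)‖ ≤ ‖sumOperator hx a‖ :=
      ((φ n).le_of_opNorm_le (hφ n) _).trans (one_mul _).le
    have h3 : ε * ‖a n‖ ≤ ‖a n * φ n (x n)‖ := by
      rw [norm_mul, mul_comm]; gcongr; exact hdiag n
    have h4 := norm_sub_norm_le (a n * φ n (x n)) (φ n (sumOperator hx a))
    rw [norm_sub_rev] at h4
    linarith
  have : ‖a‖ ≤ (‖sumOperator hx a‖ + ε / 2 * ‖a‖) / ε :=
    norm_le_of_zeroAtInfty fun n => by
      rw [le_div_iff₀ hε, mul_comm]; exact key n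
  rw [le_div_iff₀ hε] at this
  rw [div_mul_eq_mul_div, le_div_iff₀ hε]
  linarith

/-- **Bessaga–Pełczyński**: a sequence with bounded subset sums that is bounded away from zero has
a subsequence equivalent to the unit vector basis of `c₀`. -/
theorem exists_subsequence_equiv_zeroAtInfty (hx : ∀ s : Finset ℕ, ‖∑ i ∈ s, x i‖ ≤ C) {ε : ℝ}
    (hε : 0 < ε) (hxε : ∀ n, ε ≤ ‖x n‖) :
    ∃ g : ℕ → ℕ, StrictMono g ∧ ∃ (Y : Submodule 𝕜 X) (e : C₀(ℕ, 𝕜) ≃L[𝕜] Y),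
      ∀ n, (e (unitVector 𝕜 n) : X) = x (g n) := by
  have hφ : ∀ n, ∃ φ : StrongDual 𝕜 X, ‖φ‖ ≤ 1 ∧ φ (x n) = ‖x n‖ :=
    fun n => exists_dual_vector'' 𝕜 (x n)
  choose φ hφ1 hφ2 using hφ
  have hC : 0 ≤ C := (norm_nonneg _).trans (hx ∅)
  -- The row sums of `‖φ n (x m)‖` are at most `4 * C`; `δ = ε / 2` is half the lower bound on the
  -- diagonal.
  obtain ⟨g, hg, hgs⟩ := exists_strictMono_offDiag_tsum_le
    (r := fun n m => ENNReal.ofReal ‖φ n (x m)‖) (C := ENNReal.ofReal (4 * C))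
    (δ := ENNReal.ofReal (ε / 2)) ENNReal.ofReal_ne_top ENNReal.ofReal_ne_top (by simpa using hε)
    (fun n => by
      rw [ENNReal.tsum_eq_iSup_sum]
      refine iSup_le fun s => ?_
      rw [← ENNReal.ofReal_sum_of_nonneg fun _ _ => norm_nonneg _]
      refine ENNReal.ofReal_le_ofReal ((sum_norm_dual_le hx (φ n) s).trans ?_)
      exact mul_le_of_le_one_right (by positivity) (hφ1 n))
  have hxg : ∀ s : Finset ℕ, ‖∑ i ∈ s, x (g i)‖ ≤ C := fun s => by
    simpa using hx (s.map ⟨g, hg.injective⟩)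
  have hbd := norm_le_norm_sumOperator (𝕜 := 𝕜) hxg hε (φ := fun n => φ (g n))
    (fun n => hφ1 _) (fun n => by simpa [hφ2] using hxε (g n)) (fun n s hs => by
      have : ENNReal.ofReal (∑ m ∈ s, ‖φ (g n) (x (g m))‖) ≤ ENNReal.ofReal (ε / 2) := by
        rw [ENNReal.ofReal_sum_of_nonneg fun _ _ => norm_nonneg _]
        refine le_trans (le_of_eq (Finset.sum_congr rfl fun m hm => ?_))
          ((ENNReal.sum_le_tsum s).trans (hgs n))
        rw [if_neg (ne_of_mem_of_not_mem hm hs)]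
      exact (ENNReal.ofReal_le_ofReal_iff (by positivity)).1 this)
  have hanti : AntilipschitzWith (Real.toNNReal (2 / ε)) (sumOperator (𝕜 := 𝕜) hxg) :=
    AddMonoidHomClass.antilipschitz_of_bound _ fun a => by
      rw [Real.coe_toNNReal _ (by positivity)]; exact hbd a
  refine ⟨g, hg, (sumOperator (𝕜 := 𝕜) hxg).range,
    (sumOperator (𝕜 := 𝕜) hxg).equivRange hanti.injective
      (hanti.isClosed_range (sumOperator (𝕜 := 𝕜) hxg).uniformContinuous), fun n => ?_⟩
  exact sumOperator_unitVector hxg n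

end NullSequences
-- From a non-recurrent function with recurrent differences to `c₀`
section Loomis

variable {X : Type*} [NormedAddCommGroup X]

theorem IsRelativelyDense.mono {G : Type*} [AddCommGroup G] [TopologicalSpace G] {E E' : Set G}
    (hE : IsRelativelyDense E) (h : E ⊆ E') : IsRelativelyDense E' := by
  obtain ⟨L, hL, hEL⟩ := hE
  exact ⟨L, hL, Set.eq_univ_of_univ_subset (hEL ▸ Set.add_subset_add_right h)⟩

/-- The difference `Δ_τ F(t) = F(t + τ) - F(t)`. -/
def shiftDiff (F : ℝ → X) (τ t : ℝ) : X := F (t + τ) - F t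

/-- `Δ_h` and `Δ_τ` commute, so each step of length `h` changes `Δ_τ F` by at most `δ`. -/
theorem norm_shiftDiff_add_nat_mul_sub_le {F : ℝ → X} {h δ R τ : ℝ} (hh : 0 ≤ h)
    (hτ : τ ∈ periods (shiftDiff F h) δ (Metric.closedBall 0 R)) {t : ℝ} (n : ℕ)
    (ht : |t| + n * h ≤ R) :
    ‖shiftDiff F τ (t + n * h) - shiftDiff F τ t‖ ≤ n * δ := by
  induction n with
  | zero => simp
  | succ n ih =>
    push_cast at ht ⊢
    have h1 := ih (by nlinarith)
    have hmem : t + n * h ∈ Metric.closedBall (0 : ℝ) R := by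
      rw [mem_closedBall_zero_iff, Real.norm_eq_abs]
      have h2 : |n * h| = n * h := abs_of_nonneg (by positivity)
      have := abs_add_le t (n * h)
      linarith
    have h2 := hτ _ hmem
    have e : shiftDiff F τ (t + (n + 1) * h) - shiftDiff F τ t =
        (shiftDiff F h (t + n * h + τ) - shiftDiff F h (t + n * h)) +
          (shiftDiff F τ (t + n * h) - shiftDiff F τ t) := by
      simp only [shiftDiff]
      rw [show t + (n + 1) * h + τ = t + n * h + τ + h by ring,
        show t + (n + 1) * h = t + n * h + h by ring]
      abel
    rw [e]
    refine (norm_add_le _ _).trans ?_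
    linarith

theorem norm_shiftDiff_add_int_mul_sub_le {F : ℝ → X} {h δ R τ : ℝ} (hh : 0 ≤ h)
    (hτ : τ ∈ periods (shiftDiff F h) δ (Metric.closedBall 0 R)) {t : ℝ} (j : ℤ)
    (ht : |t| + 2 * |j * h| ≤ R) :
    ‖shiftDiff F τ (t + j * h) - shiftDiff F τ t‖ ≤ |(j : ℝ)| * δ := by
  have hj := abs_nonneg (j * h)
  obtain ⟨n, rfl | rfl⟩ := j.eq_nat_or_neg
  · have hn : |((n : ℤ) : ℝ) * h| = n * h := by
      rw [Int.cast_natCast, abs_of_nonneg (by positivity)]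
    have := norm_shiftDiff_add_nat_mul_sub_le hh hτ (t := t) n (by linarith)
    simpa using this
  · have hn : |((-(n : ℤ) : ℤ) : ℝ) * h| = n * h := by
      rw [abs_mul, abs_of_nonneg hh]; simp
    -- Negative multiples are walked upwards from `t - n * h`, whence the factor 2 in the
    -- hypothesis.
    have := norm_shiftDiff_add_nat_mul_sub_le hh hτ (t := t - n * h) n (by
      have h1 := abs_sub t (n * h)
      rw [abs_of_nonneg (by positivity : 0 ≤ n * h)] at h1
      linarith)
    rw [norm_sub_rev]
    simpa [sub_eq_add_neg] using this

theorem exists_common_denominator (S : Finset ℚ) {η : ℝ} (hη : 0 < η) :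
    ∃ h : ℝ, 0 < h ∧ h < η ∧ ∀ s ∈ S, ∃ j : ℤ, (s : ℝ) = j * h := by
  obtain ⟨m, hm⟩ := exists_nat_one_div_lt hη
  have hP : 0 < ∏ s ∈ S, s.den := Finset.prod_pos fun s _ => s.den_pos
  have hP1 : (1 : ℝ) ≤ ((∏ s ∈ S, s.den : ℕ) : ℝ) := by exact_mod_cast hP
  set P : ℕ := ∏ s ∈ S, s.den with hPdef
  refine ⟨1 / ((m + 1) * P), by positivity, lt_of_le_of_lt ?_ hm, fun s hs => ?_⟩
  · gcongr
    exact le_mul_of_one_le_right (by positivity) hP1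
  · obtain ⟨c, hc⟩ : s.den ∣ P := Finset.dvd_prod_of_mem _ hs
    refine ⟨s.num * (m + 1) * c, ?_⟩
    have hd : (s.den : ℝ) ≠ 0 := by exact_mod_cast s.den_ne_zero
    have hc0 : (c : ℝ) ≠ 0 := by
      rintro h
      rw [hc, Nat.cast_mul, h] at hP1
      norm_num at hP1
    have hm0 : (m + 1 : ℝ) ≠ 0 := by positivity
    rw [hc, Rat.cast_def]
    push_cast
    field_simp

theorem continuous_shiftDiff {F : ℝ → X} (hF : Continuous F) (τ : ℝ) :
    Continuous (shiftDiff F τ) := by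
  unfold shiftDiff
  fun_prop

/-- Take `h < b - a` dividing all of `S`. Almost `h`-periodicity of `Δ_τ F` carries a large value
from `K` into `(a, b)` and makes shifts by `S` harmless. A rational `τ` keeps later finite sums of
shifts commensurable. -/
theorem exists_large_shiftDiff {F : ℝ → X} (hF : Continuous F)
    (hΔ : ∀ h, 0 < h → IsRecurrent (shiftDiff F h)) (hn : ¬ IsRecurrent F) :
    ∃ ε > 0, ∀ (S : Finset ℚ) (a b : ℝ), a < b → ∀ δ > 0, ∃ τ : ℚ, ∃ t ∈ Set.Ioo a b,
      ε < ‖shiftDiff F τ t‖ ∧ ∀ s ∈ S, ‖shiftDiff F τ (t + s) - shiftDiff F τ t‖ < δ := by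
  unfold IsRecurrent at hn
  push Not at hn
  obtain ⟨K, hK, ε, hε, hE⟩ := hn hF
  obtain ⟨R₀, hR₀, hKR⟩ := hK.isBounded.subset_closedBall_lt 0 0
  refine ⟨ε / 2, by positivity, fun S a b hab δ hδ => ?_⟩
  obtain ⟨h, hh, hhab, hS⟩ := exists_common_denominator S (sub_pos.2 hab)
  set Q : ℝ := |a| + |b| + R₀ + ∑ s ∈ S, |(s : ℝ)| with hQdef
  have hsum : 0 ≤ ∑ s ∈ S, |(s : ℝ)| := Finset.sum_nonneg fun _ _ => abs_nonneg _
  have hQ : 0 < Q := by positivity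
  set ρ : ℝ := min δ (ε / 2) with hρdef
  have hρ : 0 < ρ := by positivity
  have hρδ : ρ ≤ δ := min_le_left _ _
  have hρε : ρ ≤ ε / 2 := min_le_right _ _
  -- `Q` bounds all points and displacements used below: at most `Q / h` steps give total error `ρ /
  -- 2`, and `|u| + 2 * |j * h| ≤ 3 * Q`.
  obtain ⟨τ₀, hτ₀, hτ₀'⟩ : ∃ τ₀ ∈ periods (shiftDiff F h) (ρ * h / (2 * Q))
      (Metric.closedBall 0 (3 * Q)), τ₀ ∉ periods F ε K := by
    by_contra! H
    exact hE (((hΔ h hh).2 _ (isCompact_closedBall _ _) _ (by positivity)).mono H)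
  have small : ∀ (u : ℝ) (j : ℤ), |u| ≤ Q → |j * h| ≤ Q →
      ‖shiftDiff F τ₀ (u + j * h) - shiftDiff F τ₀ u‖ < ρ := by
    intro u j hu hj
    refine (norm_shiftDiff_add_int_mul_sub_le hh.le hτ₀ j (by linarith)).trans_lt ?_
    rw [abs_mul, abs_of_pos hh] at hj
    rw [mul_div_assoc', div_lt_iff₀ (by positivity)]
    nlinarith
  have hτ₀K : ∃ s₀ ∈ K, ε < ‖F (s₀ + τ₀) - F s₀‖ := by
    by_contra! H
    exact hτ₀' H
  obtain ⟨s₀, hs₀, hlarge⟩ := hτ₀K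
  have hs₀R : |s₀| ≤ R₀ := by simpa using hKR hs₀
  obtain ⟨j, hj⟩ : ∃ j : ℤ, s₀ + j * h ∈ Set.Ioo a b := by
    refine ⟨⌊(a - s₀) / h⌋ + 1, ?_, ?_⟩
    · have := Int.lt_floor_add_one ((a - s₀) / h)
      rw [div_lt_iff₀ hh] at this
      push_cast
      linarith
    · have := Int.floor_le ((a - s₀) / h)
      rw [le_div_iff₀ hh] at this
      push_cast
      linarith
  set t : ℝ := s₀ + j * h with htdef
  have htab : |t| ≤ |a| + |b| := by
    rw [abs_le]
    have := neg_abs_le a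
    have := le_abs_self b
    have := abs_nonneg a
    have := abs_nonneg b
    exact ⟨by linarith [hj.1], by linarith [hj.2]⟩
  have ht₀ : ε / 2 < ‖shiftDiff F τ₀ t‖ := by
    have h1 := small s₀ j (by linarith [abs_nonneg a, abs_nonneg b]) (by
      have : j * h = t - s₀ := by rw [htdef]; ring
      rw [this]
      linarith [abs_sub t s₀])
    rw [norm_sub_rev] at h1
    have h2 := norm_sub_norm_le (shiftDiff F τ₀ s₀) (shiftDiff F τ₀ t)
    have h3 : ε < ‖shiftDiff F τ₀ s₀‖ := hlarge
    linarith
  have ht₁ : ∀ s ∈ S, ‖shiftDiff F τ₀ (t + s) - shiftDiff F τ₀ t‖ < δ := by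
    intro s hs
    obtain ⟨i, hi⟩ := hS s hs
    have hsQ : |(s : ℝ)| ≤ ∑ s ∈ S, |(s : ℝ)| :=
      Finset.single_le_sum (f := fun s : ℚ => |(s : ℝ)|) (fun _ _ => abs_nonneg _) hs
    rw [hi] at hsQ ⊢
    exact (small t i (by linarith) (by linarith [abs_nonneg a, abs_nonneg b])).trans_le hρδ
  have hopen : IsOpen {τ : ℝ | ε / 2 < ‖shiftDiff F τ t‖ ∧
      ∀ s ∈ S, ‖shiftDiff F τ (t + s) - shiftDiff F τ t‖ < δ} := by
    simp only [Set.ofPred_and, Set.ofPred_forall, shiftDiff]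
    refine (isOpen_lt (by fun_prop) (by fun_prop)).inter ?_
    exact isOpen_biInter_finset fun s _ => isOpen_lt (by fun_prop) (by fun_prop)
  obtain ⟨τ, hτ⟩ := Rat.denseRange_cast.exists_mem_open hopen ⟨τ₀, ht₀, ht₁⟩
  exact ⟨τ, t, hj, hτ⟩

/-- If all differences of `F` are recurrent but `F` is not, there are shifts `τₙ` whose increments
at some point are bounded away from zero and add up along finite sums. -/
theorem exists_almost_additive_shifts {F : ℝ → X} (hF : Continuous F)
    (hΔ : ∀ h, 0 < h → IsRecurrent (shiftDiff F h)) (hn : ¬ IsRecurrent F) :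
    ∃ ε > 0, ∃ (t : ℝ) (τ : ℕ → ℝ), ∀ n, ε ≤ ‖shiftDiff F (τ n) t‖ ∧
      ∀ A ⊆ Finset.range n,
        ‖shiftDiff F (τ n) (t + ∑ i ∈ A, τ i) - shiftDiff F (τ n) t‖ ≤ (1 / 2) ^ n := by
  classical
  obtain ⟨ε, hε, key⟩ := exists_large_shiftDiff hF hΔ hn
  have step : ∀ (n : ℕ) (S : Finset ℚ) (I : {I : ℝ × ℝ // I.1 < I.2}),
      ∃ (τ : ℚ) (J : {J : ℝ × ℝ // J.1 < J.2}),
        Set.Icc J.1.1 J.1.2 ⊆ Set.Icc I.1.1 I.1.2 ∧ ∀ t ∈ Set.Icc J.1.1 J.1.2,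
          ε < ‖shiftDiff F τ t‖ ∧
            ∀ s ∈ S, ‖shiftDiff F τ (t + s) - shiftDiff F τ t‖ < (1 / 2) ^ n := by
    rintro n S ⟨⟨a, b⟩, hab⟩
    obtain ⟨τ, t, ht, hτ⟩ := key S a b hab ((1 / 2) ^ n) (by positivity)
    have hc := continuous_shiftDiff hF τ
    have hopen : IsOpen (Set.Ioo a b ∩ {t : ℝ | ε < ‖shiftDiff F τ t‖ ∧
        ∀ s ∈ S, ‖shiftDiff F τ (t + s) - shiftDiff F τ t‖ < (1 / 2) ^ n}) := by
      refine isOpen_Ioo.inter ?_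
      simp only [Set.ofPred_and, Set.ofPred_forall]
      refine (isOpen_lt (by fun_prop) (by fun_prop)).inter ?_
      exact isOpen_biInter_finset fun s _ => isOpen_lt (by fun_prop) (by fun_prop)
    obtain ⟨r, hr, hball⟩ := Metric.nhds_basis_closedBall.mem_iff.1 (hopen.mem_nhds ⟨ht, hτ⟩)
    rw [Real.closedBall_eq_Icc] at hball
    exact ⟨τ, ⟨(t - r, t + r), by simp only; linarith⟩,
      fun u hu => Set.Ioo_subset_Icc_self (hball hu).1, fun u hu => (hball hu).2⟩
  choose τ J hJ hτ using step
  -- The state holds all subset sums of the shifts chosen so far and the current closed interval;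
  -- `t` is found in the intersection of the intervals.
  let st : ℕ → Finset ℚ × {I : ℝ × ℝ // I.1 < I.2} := fun n =>
    n.rec ({0}, ⟨(0, 1), one_pos⟩) fun n p =>
      (p.1 ∪ p.1.image (· + τ n p.1 p.2), J n p.1 p.2)
  let σ : ℕ → ℚ := fun n => τ n (st n).1 (st n).2
  have hst1 : ∀ n, (st (n + 1)).1 = (st n).1 ∪ (st n).1.image (· + σ n) := fun n => rfl
  have hst2 : ∀ n, (st (n + 1)).2 = J n (st n).1 (st n).2 := fun n => rfl
  have hsums : ∀ n, ∀ A ⊆ Finset.range n, ∑ i ∈ A, σ i ∈ (st n).1 := by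
    intro n
    induction n with
    | zero =>
      intro A hA
      rw [Finset.range_zero, Finset.subset_empty] at hA
      simp [hA, st]
    | succ n ih =>
      intro A hA
      rw [hst1, Finset.mem_union]
      by_cases hnA : n ∈ A
      · refine Or.inr (Finset.mem_image.2 ⟨∑ i ∈ A.erase n, σ i, ih _ ?_, ?_⟩)
        · rw [← Finset.subset_insert_iff, ← Finset.range_add_one]
          exact hA
        · exact Finset.sum_erase_add _ _ hnA
      · refine Or.inl (ih _ ?_)
        rw [Finset.range_add_one] at hA
        exact (Finset.subset_insert_iff_of_notMem hnA).1 hA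
  obtain ⟨t, ht⟩ : (⋂ n, Set.Icc (st n).2.1.1 (st n).2.1.2).Nonempty :=
    IsCompact.nonempty_iInter_of_sequence_nonempty_isCompact_isClosed _
      (fun n => by rw [hst2]; exact hJ _ _ _)
      (fun n => Set.nonempty_Icc.2 (st n).2.2.le) isCompact_Icc fun n => isClosed_Icc
  rw [Set.mem_iInter] at ht
  refine ⟨ε, hε, t, fun n => σ n, fun n => ?_⟩
  have hn := hτ n (st n).1 (st n).2 t (by rw [← hst2]; exact ht (n + 1))
  refine ⟨hn.1.le, fun A hA => ?_⟩
  have := hn.2 _ (hsums n A hA)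
  push_cast at this
  exact this.le

/-- Adding the shifts in increasing order of index telescopes `F`; the errors `(1 / 2) ^ i` total at
most 2. -/
theorem norm_shiftDiff_sum_sub_le {F : ℝ → X} {t : ℝ} {τ : ℕ → ℝ}
    (h : ∀ n, ∀ A ⊆ Finset.range n,
      ‖shiftDiff F (τ n) (t + ∑ i ∈ A, τ i) - shiftDiff F (τ n) t‖ ≤ (1 / 2) ^ n)
    (A : Finset ℕ) :
    ‖F (t + ∑ i ∈ A, τ i) - F t - ∑ i ∈ A, shiftDiff F (τ i) t‖ ≤ 2 := by
  have key : ‖F (t + ∑ i ∈ A, τ i) - F t - ∑ i ∈ A, shiftDiff F (τ i) t‖ ≤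
      ∑ i ∈ A, (1 / 2 : ℝ) ^ i := by
    induction A using Finset.induction_on_max with
    | empty => simp
    | insert n A hA ih =>
      have hnA : n ∉ A := fun hn => (hA n hn).false
      rw [Finset.sum_insert hnA, Finset.sum_insert hnA, Finset.sum_insert hnA]
      have e : F (t + (τ n + ∑ i ∈ A, τ i)) - F t -
          (shiftDiff F (τ n) t + ∑ i ∈ A, shiftDiff F (τ i) t) =
          (shiftDiff F (τ n) (t + ∑ i ∈ A, τ i) - shiftDiff F (τ n) t) +
          (F (t + ∑ i ∈ A, τ i) - F t - ∑ i ∈ A, shiftDiff F (τ i) t) := by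
        rw [show t + (τ n + ∑ i ∈ A, τ i) = t + ∑ i ∈ A, τ i + τ n by ring]
        simp only [shiftDiff]
        abel
      rw [e]
      exact (norm_add_le _ _).trans
        (add_le_add (h n A fun i hi => Finset.mem_range.2 (hA i hi)) ih)
  exact key.trans ((summable_geometric_two.sum_le_tsum A fun _ _ => by positivity).trans
    tsum_geometric_two.le)

variable {𝕜 : Type*} [RCLike 𝕜] [NormedSpace 𝕜 X] [CompleteSpace X]

variable (𝕜) in
theorem exists_equiv_zeroAtInfty_of_not_isRecurrent {F : ℝ → X} (hF : F ∈ Cb ℝ X)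
    (hΔ : ∀ h, 0 < h → IsRecurrent (shiftDiff F h)) (hn : ¬ IsRecurrent F) :
    ∃ (t : ℝ) (τ : ℕ → ℝ) (Y : Submodule 𝕜 X) (e : C₀(ℕ, 𝕜) ≃L[𝕜] Y),
      (∀ n, (e (unitVector 𝕜 n) : X) = shiftDiff F (τ n) t) ∧
      (∃ C, ∀ A : Finset ℕ, ‖∑ i ∈ A, shiftDiff F (τ i) t‖ ≤ C) ∧
      ∀ n, ‖shiftDiff F (τ n) (t + ∑ i ∈ Finset.range n, τ i) - shiftDiff F (τ n) t‖ ≤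
        (1 / 2) ^ n := by
  obtain ⟨ε, hε, t, τ, hτ⟩ := exists_almost_additive_shifts hF.1 hΔ hn
  obtain ⟨M, hM⟩ := hF.2.exists_norm_le
  have hM' : ∀ s, ‖F s‖ ≤ M := fun s => hM _ ⟨s, rfl⟩
  have hC : ∀ A : Finset ℕ, ‖∑ i ∈ A, shiftDiff F (τ i) t‖ ≤ 2 * M + 2 := by
    intro A
    have h1 := norm_shiftDiff_sum_sub_le (fun n => (hτ n).2) A
    have h2 := norm_sub_norm_le (∑ i ∈ A, shiftDiff F (τ i) t) (F (t + ∑ i ∈ A, τ i) - F t)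
    rw [norm_sub_rev (∑ i ∈ A, shiftDiff F (τ i) t)] at h2
    have h3 := norm_sub_le (F (t + ∑ i ∈ A, τ i)) (F t)
    linarith [hM' t, hM' (t + ∑ i ∈ A, τ i)]
  obtain ⟨g, hg, Y, e, he⟩ :=
    exists_subsequence_equiv_zeroAtInfty (𝕜 := 𝕜) hC hε fun n => (hτ n).1
  refine ⟨t, τ ∘ g, Y, e, he, ⟨2 * M + 2, fun A => ?_⟩, fun n => ?_⟩
  · simpa using hC (A.map ⟨g, hg.injective⟩)
  · have := (hτ (g n)).2 ((Finset.range n).map ⟨g, hg.injective⟩) (by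
      intro i hi
      simp only [Finset.mem_map, Finset.mem_range, Function.Embedding.coeFn_mk] at hi ⊢
      obtain ⟨k, hk, rfl⟩ := hi
      exact hg hk)
    rw [Finset.sum_map] at this
    exact this.trans (pow_le_pow_of_le_one (by norm_num) (by norm_num) hg.le_apply)

theorem loomisCondition_of_not_containsC0 (hX : ¬ ContainsC0 𝕜 X) :
    LoomisCondition (REC ℝ X) (Cb ℝ X) := by
  intro F hF hΔ
  by_contra hn
  obtain ⟨-, -, Y, e, -⟩ := exists_equiv_zeroAtInfty_of_not_isRecurrent 𝕜 hF hΔ hn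
  exact hX ⟨Y, ⟨e⟩⟩

variable (𝕜) in
theorem loomisCondition_cbWscp : LoomisCondition (REC ℝ X) (CbWscp 𝕜 ℝ X) := by
  intro F hF hΔ
  by_contra hn
  obtain ⟨t, τ, Y, e, he, ⟨C, hC⟩, hτ⟩ :=
    exists_equiv_zeroAtInfty_of_not_isRecurrent 𝕜 hF.1 hΔ hn
  set y : ℕ → X := fun n => F (t + ∑ i ∈ Finset.range n, τ i) with hy
  set p : ℕ → X := fun n => ∑ i ∈ Finset.range n, shiftDiff F (τ i) t with hp
  -- The increments of `y - p` are exactly the errors bounded by `(1 / 2) ^ n`.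
  obtain ⟨r, hr⟩ : ∃ r, Tendsto (fun n => y n - p n) atTop (𝓝 r) := by
    refine cauchySeq_tendsto_of_complete
      (cauchySeq_of_le_geometric (1 / 2) 1 (by norm_num) fun n => ?_)
    rw [dist_comm, dist_eq_norm, one_mul]
    have hyn : y (n + 1) = y n + shiftDiff F (τ n) (t + ∑ i ∈ Finset.range n, τ i) := by
      simp [hy, shiftDiff, Finset.sum_range_succ, add_assoc]
    have hpn : p (n + 1) = p n + shiftDiff F (τ n) t := Finset.sum_range_succ _ _
    rw [hyn, hpn, add_sub_add_comm, add_sub_cancel_left]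
    exact hτ n
  have hpφ : ∀ φ : StrongDual 𝕜 X, ∃ l, Tendsto (fun n => φ (p n)) atTop (𝓝 l) := by
    intro φ
    have hs : Summable fun i => φ (shiftDiff F (τ i) t) :=
      .of_norm (summable_of_sum_le (fun _ => norm_nonneg _) (sum_norm_dual_le hC φ))
    exact ⟨_, by simpa [hp] using hs.hasSum.tendsto_sum_nat⟩
  -- As `y` lies in the range of `F` and is weakly Cauchy, it has a weak limit `a`; then `p` would
  -- converge weakly to `a - r`.
  obtain ⟨a, ha⟩ := hF.2 y (fun n => ⟨_, rfl⟩) fun φ => by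
    obtain ⟨l, hl⟩ := hpφ φ
    have := (((φ.continuous.tendsto r).comp hr).add hl).cauchySeq
    simpa using this
  refine not_tendsto_weakly_sum_unitVector e (a - r) fun φ => ?_
  have := (ha φ).sub ((φ.continuous.tendsto r).comp hr)
  simpa [he, hp] using this

end Loomis

/-! ### Indefinite integrals -/

section Integral

variable {X : Type*} [NormedAddCommGroup X] [NormedSpace ℝ X]

/-- The difference at `t` is the integral of `f` over `[t, t + h]`, so `ε / h`-periods of `f` on `K
+ [0, h]` suffice. -/
theorem isRecurrent_shiftDiff_indefIntegral {f : ℝ → X} (hf : IsRecurrent f) {h : ℝ} (hh : 0 < h)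
    (hc : Continuous (indefIntegral f)) : IsRecurrent (shiftDiff (indefIntegral f) h) := by
  have hint : ∀ a b, IntervalIntegrable f MeasureTheory.volume a b := hf.1.intervalIntegrable
  have heq : ∀ t, shiftDiff (indefIntegral f) h t = ∫ s in (0 : ℝ)..h, f (t + s) := by
    intro t
    rw [intervalIntegral.integral_comp_add_left, add_zero]
    exact intervalIntegral.integral_interval_sub_left (hint _ _) (hint _ _)
  refine ⟨continuous_shiftDiff hc h, fun K hK ε hε => ?_⟩
  refine (hf.2 (K + Set.Icc 0 h) (hK.add isCompact_Icc) (ε / h) (by positivity)).mono ?_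
  intro τ hτ t ht
  have hi : ∀ u, IntervalIntegrable (fun s => f (u + s)) MeasureTheory.volume 0 h := fun u =>
    (hf.1.comp (by fun_prop)).intervalIntegrable _ _
  rw [heq, heq, ← intervalIntegral.integral_sub (hi _) (hi _)]
  refine (intervalIntegral.norm_integral_le_of_norm_le_const (C := ε / h) fun s hs => ?_).trans ?_
  · rw [Set.uIoc_of_le hh.le] at hs
    have := hτ (t + s) (Set.add_mem_add ht ⟨hs.1.le, hs.2⟩)
    rwa [add_right_comm] at this
  · rw [sub_zero, abs_of_pos hh, div_mul_cancel₀ _ hh.ne']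

theorem integralCondition_of_loomisCondition {U : Set (ℝ → X)} (hU : U ⊆ Cb ℝ X)
    (h : LoomisCondition (REC ℝ X) U) : IntegralCondition (REC ℝ X) U := fun _ hf _ hF =>
  h _ hF fun _ hh => isRecurrent_shiftDiff_indefIntegral hf hh (hU hF).1

end Integral

end RecurrentFunctions

theorem theorem4p5 {𝕜 X : Type*} [RCLike 𝕜] [NormedAddCommGroup X] [NormedSpace ℝ X]
    [NormedSpace 𝕜 X] [IsScalarTower ℝ 𝕜 X] [CompleteSpace X] :
    (¬ RecurrentFunctions.ContainsC0 𝕜 X →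
      RecurrentFunctions.LoomisCondition
          (RecurrentFunctions.REC ℝ X) (RecurrentFunctions.Cb ℝ X) ∧
        RecurrentFunctions.IntegralCondition
          (RecurrentFunctions.REC ℝ X) (RecurrentFunctions.Cb ℝ X)) ∧
    (RecurrentFunctions.LoomisCondition
        (RecurrentFunctions.REC ℝ X) (RecurrentFunctions.CbWscp 𝕜 ℝ X) ∧
      RecurrentFunctions.IntegralCondition
        (RecurrentFunctions.REC ℝ X) (RecurrentFunctions.CbWscp 𝕜 ℝ X)) := by
  open RecurrentFunctions in
  exact ⟨fun hX => ⟨loomisCondition_of_not_containsC0 hX,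
      integralCondition_of_loomisCondition subset_rfl (loomisCondition_of_not_containsC0 hX)⟩,
    loomisCondition_cbWscp 𝕜,
    integralCondition_of_loomisCondition (fun _ hF => hF.1) (loomisCondition_cbWscp 𝕜)⟩
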